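/- Let $d\ge 1$ and $N\ge 2$ be integers and let $I\subset(0,d)$ be a closed bounded interval. For $s\in(0,d)$ and a Borel probability measure $\mu$ on $\mathbb R^d$, let $\Pi_N(\mu)$ be the set of Borel probability measures $\gamma$ on $(\mathbb R^d)^N$ that are invariant under permutations of the $N$ factors and whose $N$ marginals on $\mathbb R^d$ are all equal to $\mu$, and put $$\mathcal F_{N,s}(\mu)=\inf_{\gamma\in\Pi_N(\mu)}\int_{(\mathbb R^d)^N}\sum_{\substack{i,j=1\\ i\ne j}}^N\frac{1}{|x_i-x_j|^{s}}\,d\gamma(x_1,\dots,x_N),$$ $$E^{\mathrm{xc}}_{N,s}(\mu)=\mathcal F_{N,s}(\mu)-N^2\int_{\mathbb R^d}\int_{\mathbb R^d}\frac{1}{|x-y|^{s}}\,d\mu(x)\,d\mu(y),$$ where $|0|^{-s}=+\infty$. Let $\mu$ be a probability measure on $\mathbb R^d$ with density $\rho\ge 0$ with respect to Lebesgue measure, such that $\rho\in L^{1+s/d}(\mathbb R^d)$ for every $s\in I$. Then for every $s$ in the interior $\mathrm{int}(I)$ both $\mathcal F_{N,s}(\mu)$ and $\int\int|x-y|^{-s}\,d\mu(x)\,d\mu(y)$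 are finite and the infimum defining $\mathcal F_{N,s}(\mu)$ is attained, and the following hold. (a) The function $s\mapsto\mathcal F_{N,s}(\mu)$ is continuous on $\mathrm{int}(I)$: $\lim_{s\to s_0}\mathcal F_{N,s}(\mu)=\mathcal F_{N,s_0}(\mu)$ for all $s_0\in\mathrm{int}(I)$. Moreover, if $s_0\in\mathrm{int}(I)$, $s_n\in\mathrm{int}(I)$, $s_n\to s_0$, and $\gamma_n$ is a minimizer for $\mathcal F_{N,s_n}(\mu)$ for each $n$, then a subsequence of $(\gamma_n)$ converges weakly to a minimizer for $\mathcal F_{N,s_0}(\mu)$. (b) The function $s\mapsto E^{\mathrm{xc}}_{N,s}(\mu)$ is continuous on $\mathrm{int}(I)$: $\lim_{s\to s_0}E^{\mathrm{xc}}_{N,s}(\mu)=E^{\mathrm{xc}}_{N,s_0}(\mu)$ for all $s_0\in\mathrm{int}(I)$. -/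

import Mathlib

open MeasureTheory Filter Topology
open scoped ENNReal

noncomputable section

/-- The Euclidean space `ℝ^d`. -/
abbrev Rd (d : ℕ) : Type := EuclideanSpace ℝ (Fin d)

/-- The Riesz cost `c(x) = |x|^{-s}`, with values in `[0, +∞]`; for `s > 0` it is `+∞` at `x = 0`. -/
def rieszCost {d : ℕ} (s : ℝ) (x : Rd d) : ℝ≥0∞ := ‖x‖ₑ ^ (-s)

/-- The pair interaction `∑_{i ≠ j} c(x_i - x_j)`, summed over ordered pairs of distinct indices. -/
def pairCost {d N : ℕ} (s : ℝ) (x : Fin N → Rd d) : ℝ≥0∞ :=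
  ∑ i : Fin N, ∑ j ∈ Finset.univ.filter (fun j => j ≠ i), rieszCost s (x i - x j)

/-- The probability measures on `(ℝ^d)^N` that are invariant under all permutations of the `N`
factors and have all `N` one-body marginals equal to `μ`. -/
def symPlans {d : ℕ} (N : ℕ) (μ : ProbabilityMeasure (Rd d)) :
    Set (ProbabilityMeasure (Fin N → Rd d)) :=
  {γ | (∀ σ : Equiv.Perm (Fin N),
          (γ : Measure (Fin N → Rd d)).map (fun x i => x (σ i)) = (γ : Measure (Fin N → Rd d))) ∧
       (∀ i : Fin N,
          (γ : Measure (Fin N → Rd d)).map (fun x => x i) = (μ : Measure (Rd d)))}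

/-- The transport cost of a plan. -/
def planCost {d N : ℕ} (s : ℝ) (γ : ProbabilityMeasure (Fin N → Rd d)) : ℝ≥0∞ :=
  ∫⁻ x, pairCost s x ∂(γ : Measure (Fin N → Rd d))

/-- The `N`-marginal optimal transport cost `F_{N,s}(μ)`, with values in `[0, +∞]`. -/
def otCost {d : ℕ} (N : ℕ) (s : ℝ) (μ : ProbabilityMeasure (Rd d)) : ℝ≥0∞ :=
  ⨅ γ ∈ symPlans N μ, planCost s γ

/-- `γ` is a minimizer for `F_{N,s}(μ)`. -/
def IsOptimalPlan {d N : ℕ} (s : ℝ) (μ : ProbabilityMeasure (Rd d))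
    (γ : ProbabilityMeasure (Fin N → Rd d)) : Prop :=
  γ ∈ symPlans N μ ∧ planCost s γ = otCost N s μ

/-- The mean-field energy `∫∫ c(x - y) dμ(x) dμ(y)`, with values in `[0, +∞]`. -/
def meanFieldEnergy {d : ℕ} (s : ℝ) (μ : ProbabilityMeasure (Rd d)) : ℝ≥0∞ :=
  ∫⁻ x, ∫⁻ y, rieszCost s (x - y) ∂(μ : Measure (Rd d)) ∂(μ : Measure (Rd d))

/-- The exchange-correlation energy `F_{N,s}(μ) - N² ∫∫ c(x - y) dμ(x) dμ(y)`, a real number;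
it is meaningful when both terms are finite. -/
def exchangeCorrelation {d : ℕ} (N : ℕ) (s : ℝ) (μ : ProbabilityMeasure (Rd d)) : ℝ :=
  (otCost N s μ).toReal - (N : ℝ) ^ 2 * (meanFieldEnergy s μ).toReal

end

section RieszTransport

variable {d N : ℕ}

/-! Lower semicontinuity comes from compactness: fixed marginals make `symPlans` tight and closed,
and the cost is jointly lower semicontinuous in exponent and plan (`planCost_le_liminf`). This also
yields minimizers and, once continuity is known, the optimality of weak limits of minimizers.

Upper semicontinuity is the hard half. A plan of finite cost for some `b > s₀` has cost continuous
at `s₀` by dominated convergence, but a near-optimal plan for `s₀` may have infinite cost for every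
larger exponent. `exists_plan_finite_cost` repairs it: the small part of the plan where the `b`-cost
is large is removed, and its one-body marginal is coupled independently with a well-behaved part of
the plan (`exists_swapped_plan`). The new interactions are controlled by the mean-field energy of
`μ`, finite by a Young-type inequality (`meanFieldEnergy_lt_top`). The mean-field energy is itself
continuous in the exponent by domination. -/

/-! ### Dependence of the pointwise cost on the exponent -/

theorem ENNReal.rpow_neg_le_one_add {s b : ℝ} (hs : 0 ≤ s) (hsb : s ≤ b) (r : ℝ≥0∞) :
    r ^ (-s) ≤ 1 + r ^ (-b) := by
  rcases le_total r 1 with h | h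
  · exact (ENNReal.rpow_le_rpow_of_exponent_ge h (by linarith)).trans le_add_self
  · exact ((ENNReal.rpow_le_rpow_of_exponent_le h (neg_nonpos.2 hs)).trans_eq
      (ENNReal.rpow_zero)).trans le_self_add

/-- Weighted AM-GM for `a` and `1` with weights `t` and `1 - t`. The error is uniform in `a` and
vanishes as `t → 1`, so nearby exponents compare up to a small constant even at the singularity. -/
theorem ENNReal.rpow_le_add_ofReal_one_sub {t : ℝ} (ht : 0 < t) (ht1 : t ≤ 1) (a : ℝ≥0∞) :
    a ^ t ≤ a + ENNReal.ofReal (1 - t) := by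
  induction a with
  | top => simp
  | coe a =>
    have h := Real.geom_mean_le_arith_mean2_weighted ht.le (sub_nonneg.2 ht1) a.coe_nonneg
      zero_le_one (by ring)
    have h2 : ((a : ℝ)) ^ t ≤ a + (1 - t) := by
      rw [Real.one_rpow] at h
      nlinarith [a.coe_nonneg]
    rw [← ENNReal.ofReal_coe_nnreal, ENNReal.ofReal_rpow_of_nonneg a.coe_nonneg ht.le,
      ← ENNReal.ofReal_add a.coe_nonneg (by linarith)]
    exact ENNReal.ofReal_le_ofReal h2

theorem ENNReal.continuousAt_rpow_neg_exponent {s : ℝ} (hs : 0 < s) {r : ℝ≥0∞} (hr : r ≠ ∞) :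
    Tendsto (fun t : ℝ => r ^ (-t)) (𝓝 s) (𝓝 (r ^ (-s))) := by
  rcases eq_or_ne r 0 with rfl | h0
  · refine Tendsto.congr' ?_ tendsto_const_nhds
    filter_upwards [lt_mem_nhds hs] with t ht
    rw [ENNReal.zero_rpow_of_neg (by linarith), ENNReal.zero_rpow_of_neg (by linarith)]
  · lift r to NNReal using hr
    have h0' : r ≠ 0 := by simpa using h0
    simp only [← ENNReal.coe_rpow_of_ne_zero h0']
    refine ENNReal.tendsto_coe.2 ?_
    exact (NNReal.continuousAt_rpow (Or.inl h0')).tendsto.comp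
      (tendsto_const_nhds.prodMk_nhds tendsto_id.neg)

theorem continuous_rieszCost (s : ℝ) : Continuous (rieszCost (d := d) s) :=
  ENNReal.continuous_rpow_const.comp continuous_enorm

theorem measurable_rieszCost (s : ℝ) : Measurable (rieszCost (d := d) s) :=
  (continuous_rieszCost s).measurable

theorem rieszCost_sub_comm (s : ℝ) (x y : Rd d) : rieszCost s (x - y) = rieszCost s (y - x) := by
  rw [rieszCost, rieszCost, ← enorm_neg, neg_sub]

theorem rieszCost_le_one_add {s b : ℝ} (hs : 0 ≤ s) (hsb : s ≤ b) (x : Rd d) :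
    rieszCost s x ≤ 1 + rieszCost b x :=
  ENNReal.rpow_neg_le_one_add hs hsb _

theorem rieszCost_le_add_ofReal {s t : ℝ} (hs : 0 < s) (hst : s ≤ t) (x : Rd d) :
    rieszCost s x ≤ rieszCost t x + ENNReal.ofReal (1 - s / t) := by
  have ht : 0 < t := hs.trans_le hst
  have h := ENNReal.rpow_le_add_ofReal_one_sub (div_pos hs ht) ((div_le_one ht).2 hst)
    (rieszCost t x)
  rwa [rieszCost, ← ENNReal.rpow_mul, show -t * (s / t) = -s by field_simp] at h

theorem tendsto_rieszCost_exponent {s : ℝ} (hs : 0 < s) (x : Rd d) :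
    Tendsto (fun t => rieszCost t x) (𝓝 s) (𝓝 (rieszCost s x)) :=
  ENNReal.continuousAt_rpow_neg_exponent hs enorm_ne_top

theorem rieszCost_eq_top_iff {s : ℝ} (hs : 0 < s) (x : Rd d) : rieszCost s x = ∞ ↔ x = 0 := by
  rw [rieszCost, ENNReal.rpow_eq_top_iff]
  simp [hs]

theorem continuous_pairCost (s : ℝ) : Continuous (pairCost (d := d) (N := N) s) := by
  unfold pairCost
  refine continuous_finsetSum _ fun i _ => continuous_finsetSum _ fun j _ => ?_
  exact (continuous_rieszCost s).comp ((continuous_apply i).sub (continuous_apply j))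

theorem measurable_pairCost (s : ℝ) : Measurable (pairCost (d := d) (N := N) s) :=
  (continuous_pairCost s).measurable

theorem pairCost_comp_perm (s : ℝ) (σ : Equiv.Perm (Fin N)) (x : Fin N → Rd d) :
    pairCost s (fun i => x (σ i)) = pairCost s x := by
  unfold pairCost
  refine Fintype.sum_equiv σ _ _ fun i => ?_
  simp only [Finset.sum_filter]
  refine Fintype.sum_equiv σ _ _ fun j => ?_
  simp

/-- A bound for the pair cost from a bound for the individual pairs. -/
theorem pairCost_le_add_const {s t : ℝ} {c : ℝ≥0∞}
    (h : ∀ x : Rd d, rieszCost s x ≤ rieszCost t x + c) (x : Fin N → Rd d) :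
    pairCost s x ≤ pairCost t x + N * (N * c) := by
  unfold pairCost
  calc _ ≤ ∑ i : Fin N, ∑ j ∈ Finset.univ.filter (fun j => j ≠ i),
        (rieszCost t (x i - x j) + c) := by gcongr; exact h _
    _ = (∑ i : Fin N, ∑ j ∈ Finset.univ.filter (fun j => j ≠ i), rieszCost t (x i - x j)) +
        ∑ i : Fin N, ∑ j ∈ Finset.univ.filter (fun j => j ≠ i), c := by
      simp only [Finset.sum_add_distrib]
    _ ≤ _ := by
      gcongr
      calc _ ≤ ∑ i : Fin N, ∑ j : Fin N, c := by
            gcongr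
            exact Finset.subset_univ _
        _ = _ := by simp

theorem pairCost_le_add {s b : ℝ} (hs : 0 ≤ s) (hsb : s ≤ b) (x : Fin N → Rd d) :
    pairCost s x ≤ pairCost b x + N * (N * 1) :=
  pairCost_le_add_const (fun y => (rieszCost_le_one_add hs hsb y).trans_eq (add_comm _ _)) x

theorem tendsto_pairCost_exponent {s : ℝ} (hs : 0 < s) (x : Fin N → Rd d) :
    Tendsto (fun t => pairCost t x) (𝓝 s) (𝓝 (pairCost s x)) := by
  unfold pairCost
  exact tendsto_finsetSum _ fun i _ => tendsto_finsetSum _ fun j _ =>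
    tendsto_rieszCost_exponent hs _

/-- The right-hand side does not involve `s`: all positive exponents share the same singular set. -/
theorem pairCost_eq_top_iff {s : ℝ} (hs : 0 < s) (x : Fin N → Rd d) :
    pairCost s x = ∞ ↔ ∃ i j, j ≠ i ∧ x i = x j := by
  simp [pairCost, ENNReal.sum_eq_top, rieszCost_eq_top_iff hs, sub_eq_zero]

/-- Only pairs containing the index `i` change; the factor 2 counts the two orders of such a pair.
The spurious term `j = i` only weakens the bound. -/
theorem pairCost_update_le (s : ℝ) (y : Fin N → Rd d) (i : Fin N) (x : Rd d) :
    pairCost s (Function.update y i x) ≤ pairCost s y + 2 * ∑ j, rieszCost s (x - y j) := by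
  have key : ∀ k j, j ≠ k → rieszCost s (Function.update y i x k - Function.update y i x j) ≤
      rieszCost s (y k - y j) + ((if k = i then rieszCost s (x - y j) else 0) +
        (if j = i then rieszCost s (x - y k) else 0)) := by
    intro k j hjk
    by_cases hk : k = i
    · subst hk
      simp [hjk]
    · by_cases hj : j = i
      · subst hj
        simp [hk, rieszCost_sub_comm s (y k) x]
      · simp [hk, hj]
  unfold pairCost
  calc _ ≤ ∑ k : Fin N, ∑ j ∈ Finset.univ.filter (fun j => j ≠ k),
        (rieszCost s (y k - y j) + ((if k = i then rieszCost s (x - y j) else 0) +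
        (if j = i then rieszCost s (x - y k) else 0))) := by
        refine Finset.sum_le_sum fun k _ => Finset.sum_le_sum fun j hj => key k j ?_
        simpa using hj
    _ = (∑ k : Fin N, ∑ j ∈ Finset.univ.filter (fun j => j ≠ k), rieszCost s (y k - y j)) +
        ∑ k : Fin N, ∑ j ∈ Finset.univ.filter (fun j => j ≠ k),
        ((if k = i then rieszCost s (x - y j) else 0) +
        (if j = i then rieszCost s (x - y k) else 0)) := by
      simp only [Finset.sum_add_distrib]
    _ ≤ _ := by
      gcongr
      calc _ ≤ ∑ k : Fin N, ∑ j : Fin N, ((if k = i then rieszCost s (x - y j) else 0) +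
            (if j = i then rieszCost s (x - y k) else 0)) := by
            gcongr
            exact Finset.subset_univ _
        _ = _ := by
          simp only [Finset.sum_add_distrib]
          rw [Finset.sum_comm]
          simp [two_mul]

/-! ### Continuity and semicontinuity of the cost of a plan -/

theorem tendsto_planCost_exponent {s b : ℝ} (hs : 0 < s) (hsb : s < b)
    (γ : ProbabilityMeasure (Fin N → Rd d)) (hγ : planCost b γ ≠ ∞) :
    Tendsto (fun t => planCost t γ) (𝓝 s) (𝓝 (planCost s γ)) := by
  unfold planCost
  refine tendsto_lintegral_filter_of_dominated_convergence
    (fun x => pairCost b x + N * (N * 1)) ?_ ?_ ?_ ?_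
  · exact Eventually.of_forall fun t => measurable_pairCost t
  · filter_upwards [Ioo_mem_nhds hs hsb] with t ht
    exact Eventually.of_forall fun x => pairCost_le_add ht.1.le ht.2.le x
  · rw [lintegral_add_right _ measurable_const]
    refine ENNReal.add_ne_top.2 ⟨hγ, ?_⟩
    simp [ENNReal.mul_eq_top]
  · exact Eventually.of_forall fun x => tendsto_pairCost_exponent hs x

/-- The cost is the increasing supremum of its truncations at height `K`, which are bounded
continuous test functions for weak convergence. -/
theorem planCost_le_liminf_of_tendsto (s : ℝ) {γ : ℕ → ProbabilityMeasure (Fin N → Rd d)}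
    {γ₀ : ProbabilityMeasure (Fin N → Rd d)} (h : Tendsto γ atTop (𝓝 γ₀)) :
    planCost s γ₀ ≤ liminf (fun n => planCost s (γ n)) atTop := by
  have hsup : ∀ x : Fin N → Rd d, pairCost s x = ⨆ K : ℕ, min (pairCost s x) (K : ℝ≥0∞) := by
    intro x
    refine le_antisymm ?_ (iSup_le fun K => min_le_left _ _)
    rw [← inf_iSup_eq, ENNReal.iSup_natCast, inf_top_eq]
  have hmono : Monotone fun (K : ℕ) (x : Fin N → Rd d) => min (pairCost s x) (K : ℝ≥0∞) := by
    intro K L hKL x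
    exact min_le_min_left _ (by exact_mod_cast hKL)
  have hrw : planCost s γ₀ = ⨆ K : ℕ, ∫⁻ x, min (pairCost s x) (K : ℝ≥0∞)
      ∂(γ₀ : Measure (Fin N → Rd d)) := by
    rw [← lintegral_iSup (fun K => (measurable_pairCost s).min measurable_const) hmono, planCost]
    exact lintegral_congr hsup
  rw [hrw]
  refine iSup_le fun K => ?_
  have hle : ∀ x : Fin N → Rd d, min (pairCost s x) (K : ℝ≥0∞) ≤ ((K : NNReal) : ℝ≥0∞) :=
    fun x => by simp
  let f : BoundedContinuousFunction (Fin N → Rd d) NNReal :=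
    BoundedContinuousFunction.mkOfBound
      ⟨fun x => (min (pairCost s x) (K : ℝ≥0∞)).toNNReal, by
        refine ENNReal.continuousOn_toNNReal.comp_continuous
          ((continuous_pairCost s).min continuous_const) fun x => ?_
        exact (lt_of_le_of_lt (hle x) ENNReal.coe_lt_top).ne⟩ K (by
        intro x y
        have hb : ∀ x : Fin N → Rd d, (min (pairCost s x) (K : ℝ≥0∞)).toNNReal ≤ K := fun x => by
          simpa using ENNReal.toNNReal_mono ENNReal.coe_ne_top (hle x)
        have hx : (((min (pairCost s x) (K : ℝ≥0∞)).toNNReal : NNReal) : ℝ) ≤ K := by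
          exact_mod_cast hb x
        have hy : (((min (pairCost s y) (K : ℝ≥0∞)).toNNReal : NNReal) : ℝ) ≤ K := by
          exact_mod_cast hb y
        rw [NNReal.dist_eq]
        exact abs_sub_le_of_nonneg_of_le (NNReal.coe_nonneg _) hx (NNReal.coe_nonneg _) hy)
  have hf : ∀ x, (f x : ℝ≥0∞) = min (pairCost s x) (K : ℝ≥0∞) := fun x =>
    ENNReal.coe_toNNReal (lt_of_le_of_lt (hle x) ENNReal.coe_lt_top).ne
  have ht := ProbabilityMeasure.tendsto_iff_forall_lintegral_tendsto.1 h f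
  simp only [hf] at ht
  rw [← ht.liminf_eq]
  exact liminf_le_liminf (Eventually.of_forall fun n => lintegral_mono fun x => min_le_left _ _)

/-- Lower semicontinuity of the transport cost, jointly in the exponent and the plan. -/
theorem planCost_le_liminf {s : ℕ → ℝ} {s₀ : ℝ} (hs₀ : 0 < s₀) (hs : Tendsto s atTop (𝓝 s₀))
    {γ : ℕ → ProbabilityMeasure (Fin N → Rd d)} {γ₀ : ProbabilityMeasure (Fin N → Rd d)}
    (h : Tendsto γ atTop (𝓝 γ₀)) :
    planCost s₀ γ₀ ≤ liminf (fun n => planCost (s n) (γ n)) atTop := by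
  set L := liminf (fun n => planCost (s n) (γ n)) atTop
  -- The exponent is frozen at some `r < s₀`, where semicontinuity in the plan alone applies.
  -- Eventually `s n` lies in the symmetric window `(r, 2 * s₀ - r)`, which bounds the error of
  -- changing exponent; this error vanishes as `r ↑ s₀`.
  have key : ∀ r, 0 < r → r < s₀ →
      planCost r γ₀ ≤ L + N * (N * ENNReal.ofReal (1 - r / (2 * s₀ - r))) := by
    intro r hr hrs
    set c : ℝ≥0∞ := N * (N * ENNReal.ofReal (1 - r / (2 * s₀ - r)))
    refine (planCost_le_liminf_of_tendsto r h).trans ?_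
    have hev : ∀ᶠ n in atTop, planCost r (γ n) ≤ planCost (s n) (γ n) + c := by
      filter_upwards [hs.eventually (Ioo_mem_nhds hrs (show s₀ < 2 * s₀ - r by linarith))] with n hn
      unfold planCost
      calc _ ≤ ∫⁻ x, (pairCost (s n) x + c) ∂(γ n : Measure (Fin N → Rd d)) := by
            refine lintegral_mono fun x => pairCost_le_add_const (fun y => ?_) x
            refine (rieszCost_le_add_ofReal hr hn.1.le y).trans ?_
            gcongr
            · linarith [hn.1]
            · exact hn.2.le
        _ = _ := by rw [lintegral_add_right _ measurable_const]; simp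
    refine (liminf_le_liminf hev).trans (le_of_eq ?_)
    exact liminf_add_const atTop _ c (by isBoundedDefault) (by isBoundedDefault)
  let r : ℕ → ℝ := fun k => s₀ * (1 - 1 / ((k : ℝ) + 2))
  have hr_pos : ∀ k, 0 < r k := fun k => by
    have : 1 / ((k : ℝ) + 2) < 1 := by
      rw [div_lt_one (by positivity)]; linarith [(Nat.cast_nonneg k : (0 : ℝ) ≤ k)]
    exact mul_pos hs₀ (by linarith)
  have hr_lt : ∀ k, r k < s₀ := fun k => by
    have : 0 < 1 / ((k : ℝ) + 2) := by positivity
    show s₀ * _ < s₀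
    nlinarith
  have hr : Tendsto r atTop (𝓝 s₀) := by
    have h1 : Tendsto (fun k : ℕ => 1 / ((k : ℝ) + 2)) atTop (𝓝 0) :=
      tendsto_const_nhds.div_atTop (tendsto_atTop_add_const_right _ _ tendsto_natCast_atTop_atTop)
    simpa [r] using (tendsto_const_nhds (x := s₀)).mul ((tendsto_const_nhds (x := (1 : ℝ))).sub h1)
  have hfatou : planCost s₀ γ₀ ≤ liminf (fun k => planCost (r k) γ₀) atTop := by
    unfold planCost
    refine le_trans (lintegral_mono fun x => ?_)
      (lintegral_liminf_le fun k => measurable_pairCost (r k))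
    exact ((tendsto_pairCost_exponent hs₀ x).comp hr).liminf_eq.ge
  have hlim : Tendsto (fun k => L + N * (N * ENNReal.ofReal (1 - r k / (2 * s₀ - r k)))) atTop
      (𝓝 (L + N * (N * ENNReal.ofReal (1 - s₀ / (2 * s₀ - s₀))))) := by
    refine tendsto_const_nhds.add (ENNReal.Tendsto.const_mul (ENNReal.Tendsto.const_mul
      (ENNReal.tendsto_ofReal ?_) (Or.inr (by simp))) (Or.inr (by simp)))
    exact tendsto_const_nhds.sub (hr.div (tendsto_const_nhds.sub hr) (by linarith))
  have hz : 1 - s₀ / (2 * s₀ - s₀) = 0 := by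
    rw [show 2 * s₀ - s₀ = s₀ by ring, div_self hs₀.ne', sub_self]
  rw [hz, ENNReal.ofReal_zero, mul_zero, mul_zero, add_zero] at hlim
  refine hfatou.trans ?_
  rw [← hlim.liminf_eq]
  exact liminf_le_liminf (Eventually.of_forall fun k => key (r k) (hr_pos k) (hr_lt k))

/-! ### Finiteness and continuity of the mean-field energy -/

/-- A pointwise substitute for the Young convolution inequality, with `p = 1 + t` and
`q = (1 + t) / (2 * t)`. -/
theorem ENNReal.mul_mul_le_rpow_of_le {t : ℝ} (ht : 0 < t) (ht1 : t ≤ 1) {u v k : ℝ≥0∞}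
    (huv : u ≤ v) :
    u * v * k ≤ (u * v) ^ (1 + t) + v ^ (1 + t) * k ^ ((1 + t) / (2 * t)) := by
  -- The threshold is chosen so that small `k` satisfies `k ≤ u ^ t * v ^ t`, while large `k` lets
  -- the factor `u ^ (1 - t)` be traded for a power of `k`.
  rcases le_total k (u ^ (2 * t)) with h | h
  · refine le_trans ?_ le_self_add
    calc u * v * k ≤ u * v * (u ^ t * v ^ t) := by
          gcongr
          refine h.trans ?_
          rw [two_mul, ENNReal.rpow_add_of_nonneg _ _ ht.le ht.le]
          gcongr
      _ = (u * v) ^ (1 + t) := by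
          rw [ENNReal.rpow_add_of_nonneg _ _ zero_le_one ht.le, ENNReal.rpow_one,
            ENNReal.mul_rpow_of_nonneg _ _ ht.le]
  · refine le_trans ?_ le_add_self
    have hu : u ≤ k ^ (2 * t)⁻¹ := (ENNReal.le_rpow_inv_iff (by positivity)).2 h
    have hexp : (1 + t) / (2 * t) = (2 * t)⁻¹ * (1 - t) + 1 := by field_simp; ring
    calc u * v * k = (u ^ (1 - t) * u ^ t) * v * k := by
          rw [← ENNReal.rpow_add_of_nonneg _ _ (by linarith) ht.le, sub_add_cancel,
            ENNReal.rpow_one]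
      _ ≤ ((k ^ (2 * t)⁻¹) ^ (1 - t) * v ^ t) * v * k := by
          gcongr
      _ = v ^ (1 + t) * k ^ ((1 + t) / (2 * t)) := by
          rw [hexp, ENNReal.rpow_add_of_nonneg _ _ zero_le_one ht.le, ENNReal.rpow_one,
            ENNReal.rpow_add_of_nonneg _ _ (mul_nonneg (by positivity) (by linarith)) zero_le_one,
            ENNReal.rpow_one, ENNReal.rpow_mul]
          ring

theorem lintegral_rieszCost_rpow_ball_lt_top (hd : 1 ≤ d) {b q : ℝ}
    (hbq : b * q < d) :
    ∫⁻ x in Metric.ball (0 : Rd d) 1, rieszCost b x ^ q < ∞ := by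
  have hfin : Module.finrank ℝ (Rd d) = d := by simp
  have h := integrableOn_ball_of_norm_le_rpow (E := Rd d) (μ := volume) (r := 1) (C := 1)
    (α := b * q) (f := fun x => ‖x‖ ^ (-(b * q))) (by rw [hfin]; exact hd) (by rw [hfin]; exact hbq)
    (Eventually.of_forall fun x => by
      rw [Real.norm_of_nonneg (by positivity), one_mul])
    (measurable_norm.pow_const _).aestronglyMeasurable
  have h2 := h.2
  rw [HasFiniteIntegral] at h2
  refine lt_of_le_of_lt (le_of_eq ?_) h2
  have : Nontrivial (Rd d) := Module.nontrivial_of_finrank_pos (R := ℝ) (by rw [hfin]; exact hd)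
  refine lintegral_congr_ae (ae_restrict_of_ae ?_)
  filter_upwards [Measure.ae_ne volume (0 : Rd d)] with x hx
  have hx0 : 0 < ‖x‖ := norm_pos_iff.2 hx
  rw [rieszCost, ← ENNReal.rpow_mul, ← ofReal_norm, ENNReal.ofReal_rpow_of_pos hx0,
    Real.enorm_of_nonneg (by positivity)]
  ring_nf

theorem ENNReal.mul_mul_le_rpow {t : ℝ} (ht : 0 < t) (ht1 : t ≤ 1) (u v k : ℝ≥0∞) :
    u * v * k ≤ (u * v) ^ (1 + t) +
      (u ^ (1 + t) * k ^ ((1 + t) / (2 * t)) + v ^ (1 + t) * k ^ ((1 + t) / (2 * t))) := by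
  rcases le_total u v with h | h
  · refine (ENNReal.mul_mul_le_rpow_of_le ht ht1 h).trans ?_
    gcongr
    exact le_add_self
  · have h2 := ENNReal.mul_mul_le_rpow_of_le ht ht1 (k := k) h
    rw [mul_comm v u] at h2
    refine h2.trans ?_
    gcongr
    exact le_self_add

/-- Finiteness of the mean-field energy of a density in `L^{1 + b/d}`. -/
theorem meanFieldEnergy_lt_top (hd : 1 ≤ d) {b : ℝ} (hb : 0 < b) (hbd : b < d)
    (μ : ProbabilityMeasure (Rd d)) {f : Rd d → ℝ≥0∞} (hf : Measurable f)
    (hμ : (μ : Measure (Rd d)) = volume.withDensity f)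
    (hfp : ∫⁻ x, f x ^ (1 + b / d) < ∞) : meanFieldEnergy b μ < ∞ := by
  have hd0 : (0 : ℝ) < d := by exact_mod_cast hd
  set t : ℝ := b / d with ht_def
  have ht : 0 < t := div_pos hb hd0
  have ht1 : t < 1 := (div_lt_one hd0).2 hbd
  set q : ℝ := (1 + t) / (2 * t)
  have hq : 0 < q := by positivity
  -- With `t = b / d` one gets `b * q = d * (1 + t) / 2`, below `d` exactly because `t < 1`; hence
  -- the `q`-th power of the cost is integrable near the origin.
  have hbq : b * q < d := by
    have : b * q = d * ((1 + t) / 2) := by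
      have : b = d * t := by rw [ht_def]; field_simp
      rw [this]; simp only [q]; field_simp
    rw [this]; nlinarith
  -- Only the singular part of the cost needs the density; off the unit ball the cost is at most 1
  -- and `μ` has mass 1.
  let k : Rd d → ℝ≥0∞ := (Metric.ball (0 : Rd d) 1).indicator (rieszCost b)
  have hk : Measurable k := (measurable_rieszCost b).indicator measurableSet_ball
  have hkq : ∫⁻ x, k x ^ q < ∞ := by
    refine lt_of_le_of_lt (le_of_eq ?_) (lintegral_rieszCost_rpow_ball_lt_top hd hbq)
    rw [← lintegral_indicator measurableSet_ball]
    refine lintegral_congr fun x => ?_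
    by_cases hx : x ∈ Metric.ball (0 : Rd d) 1 <;> simp [k, hx, hq]
  have hck : ∀ x : Rd d, rieszCost b x ≤ 1 + k x := by
    intro x
    by_cases hx : x ∈ Metric.ball (0 : Rd d) 1
    · simp [k, hx]
    · refine le_trans ?_ le_self_add
      have h1 : (1 : ℝ≥0∞) ≤ ‖x‖ₑ := by
        rw [← ofReal_norm, ← ENNReal.ofReal_one]
        exact ENNReal.ofReal_le_ofReal (by simpa using hx)
      exact (ENNReal.rpow_le_rpow_of_exponent_le h1 (neg_nonpos.2 hb.le)).trans_eq
        ENNReal.rpow_zero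
  have hI : ∫⁻ x, ∫⁻ y, k (x - y) ∂(μ : Measure (Rd d)) ∂(μ : Measure (Rd d)) < ∞ := by
    have h1 : ∀ x, ∫⁻ y, k (x - y) ∂(μ : Measure (Rd d)) = ∫⁻ y, f y * k (x - y) := fun x => by
      rw [hμ, lintegral_withDensity_eq_lintegral_mul _ hf (by fun_prop)]
      rfl
    simp only [h1]
    rw [hμ, lintegral_withDensity_eq_lintegral_mul _ hf
      (Measurable.lintegral_prod_right' (f := fun z : Rd d × Rd d => f z.2 * k (z.1 - z.2))
        (by fun_prop))]
    simp only [Pi.mul_apply]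
    have hle : ∀ x, f x * ∫⁻ y, f y * k (x - y) ≤
        f x ^ (1 + t) * (∫⁻ y, f y ^ (1 + t)) + (f x ^ (1 + t) * (∫⁻ y, k y ^ q) +
          ∫⁻ y, f y ^ (1 + t) * k (x - y) ^ q) := fun x => by
      rw [← lintegral_const_mul _ (by fun_prop)]
      calc _ ≤ ∫⁻ y, (f x ^ (1 + t) * f y ^ (1 + t) + (f x ^ (1 + t) * k (x - y) ^ q +
            f y ^ (1 + t) * k (x - y) ^ q)) := by
            refine lintegral_mono fun y => ?_
            rw [← ENNReal.mul_rpow_of_nonneg _ _ (by linarith), ← mul_assoc]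
            exact ENNReal.mul_mul_le_rpow ht ht1.le _ _ _
        _ = _ := by
            rw [lintegral_add_left (by fun_prop), lintegral_add_left (by fun_prop),
              lintegral_const_mul _ (by fun_prop), lintegral_const_mul _ (by fun_prop),
              lintegral_sub_left_eq_self (fun y => k y ^ q) x]
    refine lt_of_le_of_lt (lintegral_mono hle) ?_
    have hswap : ∫⁻ x, ∫⁻ y, f y ^ (1 + t) * k (x - y) ^ q =
        (∫⁻ y, f y ^ (1 + t)) * ∫⁻ x, k x ^ q := by
      rw [lintegral_lintegral_swap (Measurable.aemeasurable (by fun_prop))]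
      have : ∀ y : Rd d, ∫⁻ x, f y ^ (1 + t) * k (x - y) ^ q =
          f y ^ (1 + t) * ∫⁻ x, k x ^ q := fun y => by
        rw [lintegral_const_mul _ (by fun_prop),
          lintegral_sub_right_eq_self (fun x => k x ^ q) y]
      simp only [this]
      rw [lintegral_mul_const _ (by fun_prop)]
    rw [lintegral_add_left (by fun_prop), lintegral_add_left (by fun_prop),
      lintegral_mul_const _ (by fun_prop), lintegral_mul_const _ (by fun_prop), hswap]
    exact ENNReal.add_lt_top.2 ⟨ENNReal.mul_lt_top hfp hfp, ENNReal.add_lt_top.2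
      ⟨ENNReal.mul_lt_top hfp hkq, ENNReal.mul_lt_top hfp hkq⟩⟩
  calc meanFieldEnergy b μ
      ≤ ∫⁻ x, ∫⁻ y, (1 + k (x - y)) ∂(μ : Measure (Rd d)) ∂(μ : Measure (Rd d)) := by
        unfold meanFieldEnergy
        gcongr
        exact hck _
    _ = 1 + ∫⁻ x, ∫⁻ y, k (x - y) ∂(μ : Measure (Rd d)) ∂(μ : Measure (Rd d)) := by
        simp only [lintegral_add_left measurable_const, lintegral_const, measure_univ, mul_one]
    _ < ∞ := ENNReal.add_lt_top.2 ⟨ENNReal.one_lt_top, hI⟩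

theorem meanFieldEnergy_eq_lintegral_prod (s : ℝ) (μ : ProbabilityMeasure (Rd d)) :
    meanFieldEnergy s μ = ∫⁻ z, rieszCost s (z.1 - z.2)
      ∂((μ : Measure (Rd d)).prod (μ : Measure (Rd d))) := by
  have := measurable_rieszCost (d := d) s
  rw [lintegral_prod _ (Measurable.aemeasurable (by fun_prop)), meanFieldEnergy]

theorem meanFieldEnergy_le_one_add {s b : ℝ} (hs : 0 ≤ s) (hsb : s ≤ b)
    (μ : ProbabilityMeasure (Rd d)) : meanFieldEnergy s μ ≤ 1 + meanFieldEnergy b μ := by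
  simp only [meanFieldEnergy_eq_lintegral_prod]
  calc _ ≤ ∫⁻ z, (1 + rieszCost b (z.1 - z.2))
        ∂((μ : Measure (Rd d)).prod (μ : Measure (Rd d))) :=
        lintegral_mono fun z => rieszCost_le_one_add hs hsb _
    _ = _ := by rw [lintegral_add_left measurable_const]; simp

theorem tendsto_meanFieldEnergy_exponent {s b : ℝ} (hs : 0 < s) (hsb : s < b)
    (μ : ProbabilityMeasure (Rd d)) (hμ : meanFieldEnergy b μ ≠ ∞) :
    Tendsto (fun t => meanFieldEnergy t μ) (𝓝 s) (𝓝 (meanFieldEnergy s μ)) := by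
  simp only [meanFieldEnergy_eq_lintegral_prod] at hμ ⊢
  refine tendsto_lintegral_filter_of_dominated_convergence
    (fun z => 1 + rieszCost b (z.1 - z.2)) ?_ ?_ ?_ ?_
  · exact Eventually.of_forall fun t => (measurable_rieszCost t).comp (by fun_prop)
  · filter_upwards [Ioo_mem_nhds hs hsb] with t ht
    exact Eventually.of_forall fun z => rieszCost_le_one_add ht.1.le ht.2.le _
  · rw [lintegral_add_left measurable_const]
    exact ENNReal.add_ne_top.2 ⟨by simp, hμ⟩
  · exact Eventually.of_forall fun z => tendsto_rieszCost_exponent hs _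

/-! ### Compactness of the set of plans and its consequences -/

/-- Tightness of the single measure `μ` suffices: a point outside `K^N` has a coordinate outside
`K`, and a union bound over the `N` marginals applies. -/
theorem isTightMeasureSet_symPlans (μ : ProbabilityMeasure (Rd d)) :
    IsTightMeasureSet {((γ : ProbabilityMeasure (Fin N → Rd d)) : Measure (Fin N → Rd d)) |
      γ ∈ symPlans N μ} := by
  rw [isTightMeasureSet_iff_exists_isCompact_measure_compl_le]
  intro ε hε
  rcases Nat.eq_zero_or_pos N with rfl | hN
  · exact ⟨Set.univ, isCompact_univ, fun m _ => by simp⟩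
  have hμ := isTightMeasureSet_iff_exists_isCompact_measure_compl_le.1
    (isTightMeasureSet_singleton (μ := (μ : Measure (Rd d))))
  obtain ⟨K, hK, hKε⟩ := hμ (ε / N) (ENNReal.div_pos hε.ne' (by simp))
  refine ⟨Set.univ.pi fun _ => K, isCompact_univ_pi fun _ => hK, ?_⟩
  rintro _ ⟨γ, hγ, rfl⟩
  have hsub : (Set.univ.pi fun _ : Fin N => K)ᶜ ⊆ ⋃ i : Fin N, (fun x => x i) ⁻¹' Kᶜ := by
    intro x hx
    simpa [Set.mem_pi] using hx
  calc (γ : Measure (Fin N → Rd d)) (Set.univ.pi fun _ => K)ᶜ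
      ≤ ∑ i : Fin N, (γ : Measure (Fin N → Rd d)) ((fun x => x i) ⁻¹' Kᶜ) :=
        (measure_mono hsub).trans (measure_iUnion_fintype_le _ _)
    _ ≤ ∑ i : Fin N, ε / N := by
        refine Finset.sum_le_sum fun i _ => ?_
        rw [← Measure.map_apply (measurable_pi_apply i) hK.measurableSet.compl, hγ.2 i]
        exact hKε _ rfl
    _ = ε := by
        simp only [Finset.sum_const, Finset.card_univ, Fintype.card_fin, nsmul_eq_mul]
        exact ENNReal.mul_div_cancel (by simp [hN.ne']) (by simp)

theorem isClosed_symPlans (μ : ProbabilityMeasure (Rd d)) : IsClosed (symPlans N μ) := by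
  have hperm : ∀ σ : Equiv.Perm (Fin N),
      Continuous fun (x : Fin N → Rd d) (i : Fin N) => x (σ i) := fun σ => by fun_prop
  have heval : ∀ i : Fin N, Continuous fun x : Fin N → Rd d => x i := fun i => by fun_prop
  have h : symPlans N μ =
      (⋂ σ : Equiv.Perm (Fin N), {γ | γ.map (hperm σ).measurable.aemeasurable = γ}) ∩
      ⋂ i : Fin N, {γ | γ.map (heval i).measurable.aemeasurable = μ} := by
    ext γ
    simp only [symPlans, Set.mem_ofPred_eq, Set.mem_inter_iff, Set.mem_iInter]
    refine and_congr (forall_congr' fun σ => ?_) (forall_congr' fun i => ?_)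
    · exact ⟨fun h => Subtype.ext h, fun h => congrArg Subtype.val h⟩
    · exact ⟨fun h => Subtype.ext h, fun h => congrArg Subtype.val h⟩
  rw [h]
  refine (isClosed_iInter fun σ => ?_).inter (isClosed_iInter fun i => ?_)
  · exact isClosed_eq (ProbabilityMeasure.continuous_map (hperm σ)) continuous_id
  · exact isClosed_eq (ProbabilityMeasure.continuous_map (heval i)) continuous_const

theorem isCompact_symPlans (μ : ProbabilityMeasure (Rd d)) : IsCompact (symPlans N μ) := by
  have h := isCompact_closure_of_isTightMeasureSet (isTightMeasureSet_symPlans (N := N) μ)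
  rwa [(isClosed_symPlans μ).closure_eq] at h

/-- Existence of optimal plans. -/
theorem exists_isOptimalPlan {s : ℝ} (hs : 0 < s) {μ : ProbabilityMeasure (Rd d)}
    (hfin : otCost N s μ ≠ ∞) : ∃ γ : ProbabilityMeasure (Fin N → Rd d), IsOptimalPlan s μ γ := by
  have hex : ∀ n : ℕ, ∃ γ ∈ symPlans N μ, planCost s γ < otCost N s μ + ((n : ℝ≥0∞) + 1)⁻¹ := by
    intro n
    have h : otCost N s μ < otCost N s μ + ((n : ℝ≥0∞) + 1)⁻¹ :=
      ENNReal.lt_add_right hfin (by simp)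
    conv_lhs at h => rw [otCost]
    simpa only [iInf_lt_iff, exists_prop] using h
  choose γ hγ hcost using hex
  obtain ⟨γ₀, hγ₀, φ, hφ, hlim⟩ := (isCompact_symPlans μ).tendsto_subseq hγ
  refine ⟨γ₀, hγ₀, le_antisymm ?_ (iInf₂_le γ₀ hγ₀)⟩
  refine (planCost_le_liminf hs tendsto_const_nhds hlim).trans ?_
  have ht : Tendsto (fun k => otCost N s μ + ((φ k : ℝ≥0∞) + 1)⁻¹) atTop
      (𝓝 (otCost N s μ + 0)) := by
    refine tendsto_const_nhds.add ?_
    have : Tendsto (fun n : ℕ => ((n : ℝ≥0∞) + 1)⁻¹) atTop (𝓝 0) := by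
      have := (tendsto_add_atTop_iff_nat 1).2 ENNReal.tendsto_inv_nat_nhds_zero
      simpa using this
    exact this.comp hφ.tendsto_atTop
  rw [add_zero] at ht
  rw [← ht.liminf_eq]
  exact liminf_le_liminf (Eventually.of_forall fun k => (hcost (φ k)).le)

/-- Lower semicontinuity of the optimal transport cost in the exponent. -/
theorem eventually_lt_otCost {s₀ : ℝ} (hs₀ : 0 < s₀) {μ : ProbabilityMeasure (Rd d)} {a : ℝ≥0∞}
    (ha : a < otCost N s₀ μ) : ∀ᶠ s in 𝓝 s₀, a < otCost N s μ := by
  -- Otherwise exponents tending to `s₀` have optimal plans of cost at most `a`; a weak limit of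
  -- these is a plan for `s₀` of cost at most `a`.
  by_contra h
  rw [not_eventually] at h
  obtain ⟨s, hs, hsa⟩ := exists_seq_forall_of_frequently
    (h.and_eventually (lt_mem_nhds hs₀))
  have hopt : ∀ n, ∃ γ : ProbabilityMeasure (Fin N → Rd d), IsOptimalPlan (s n) μ γ := fun n =>
    exists_isOptimalPlan (hsa n).2 (ne_top_of_le_ne_top ha.ne_top (not_lt.1 (hsa n).1))
  choose γ hγ using hopt
  obtain ⟨γ₀, hγ₀, φ, hφ, hlim⟩ := (isCompact_symPlans μ).tendsto_subseq fun n => (hγ n).1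
  have h1 := planCost_le_liminf hs₀ (hs.comp hφ.tendsto_atTop) hlim
  have h2 : liminf (fun k => planCost ((s ∘ φ) k) ((γ ∘ φ) k)) atTop ≤ a := by
    rw [← liminf_const (f := (atTop : Filter ℕ)) a]
    exact liminf_le_liminf (Eventually.of_forall fun k =>
      (hγ (φ k)).2.trans_le (not_lt.1 (hsa (φ k)).1))
  exact absurd ((iInf₂_le γ₀ hγ₀).trans (h1.trans h2)) (not_le.2 ha)

/-! ### Permutation-invariant measures -/

/-- Invariance of a measure on `X^N` under permutations of the factors. -/
def IsPermInvariant {X : Type*} [MeasurableSpace X] (m : Measure (Fin N → X)) : Prop :=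
  ∀ σ : Equiv.Perm (Fin N), m.map (fun x i => x (σ i)) = m

theorem measurable_comp_perm {X : Type*} [MeasurableSpace X] (σ : Equiv.Perm (Fin N)) :
    Measurable fun (x : Fin N → X) i => x (σ i) :=
  measurable_pi_lambda _ fun i => measurable_pi_apply (σ i)

namespace IsPermInvariant

variable {X : Type*} [MeasurableSpace X] {m m' : Measure (Fin N → X)}

theorem add (h : IsPermInvariant m) (h' : IsPermInvariant m') : IsPermInvariant (m + m') :=
  fun σ => by rw [Measure.map_add _ _ (measurable_comp_perm σ), h σ, h' σ]

theorem smul (c : ℝ≥0∞) (h : IsPermInvariant m) : IsPermInvariant (c • m) :=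
  fun σ => by rw [Measure.map_smul, h σ]

theorem restrict (h : IsPermInvariant m) {s : Set (Fin N → X)} (hs : MeasurableSet s)
    (hsσ : ∀ (σ : Equiv.Perm (Fin N)) (x : Fin N → X), (fun i => x (σ i)) ∈ s ↔ x ∈ s) :
    IsPermInvariant (m.restrict s) := fun σ => by
  have hpre : (fun (x : Fin N → X) i => x (σ i)) ⁻¹' s = s := Set.ext fun x => hsσ σ x
  conv_rhs => rw [← h σ, Measure.restrict_map (measurable_comp_perm σ) hs, hpre]

theorem map_eval_eq (h : IsPermInvariant m) (i j : Fin N) :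
    m.map (fun x => x i) = m.map (fun x => x j) := by
  conv_lhs => rw [← h (Equiv.swap i j)]
  rw [Measure.map_map (measurable_pi_apply i) (measurable_comp_perm _)]
  congr 1
  funext x
  simp

theorem pi (η : Measure X) [SigmaFinite η] :
    IsPermInvariant (Measure.pi fun _ : Fin N => η) := fun σ => by
  refine (Measure.pi_eq fun s hs => ?_).symm
  have hpre : (fun (x : Fin N → X) i => x (σ i)) ⁻¹' Set.univ.pi s =
      Set.univ.pi fun i => s (σ.symm i) := by
    ext x
    simp only [Set.mem_preimage, Set.mem_pi, Set.mem_univ, true_imp_iff]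
    exact ⟨fun h i => by simpa using h (σ.symm i), fun h i => by simpa using h (σ i)⟩
  rw [Measure.map_apply (measurable_comp_perm σ) (MeasurableSet.univ_pi hs), hpre, Measure.pi_pi]
  exact Equiv.prod_comp σ.symm fun i => η (s i)

/-- Replacing one coordinate, in all possible positions, by an independent variable. -/
theorem sum_map_update [SFinite m] (h : IsPermInvariant m) (ν : Measure X) [SFinite ν] :
    IsPermInvariant (∑ i : Fin N,
      (m.prod ν).map fun z : (Fin N → X) × X => Function.update z.1 i z.2) := fun σ => by
  have hu : ∀ i : Fin N, Measurable fun z : (Fin N → X) × X => Function.update z.1 i z.2 :=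
    fun i => measurable_update'
  rw [← Measure.mapₗ_apply_of_measurable (measurable_comp_perm σ), map_sum]
  -- Permuting by `σ` moves the replaced slot from `i` to `σ.symm i`; the permutation of the other
  -- coordinates is absorbed by the invariance of `m`.
  refine Fintype.sum_equiv σ.symm _ _ fun i => ?_
  rw [Measure.mapₗ_apply_of_measurable (measurable_comp_perm σ),
    Measure.map_map (measurable_comp_perm σ) (hu i)]
  have hprod : m.prod ν =
      (m.prod ν).map (Prod.map (fun (x : Fin N → X) i => x (σ i)) id) := by
    rw [← Measure.map_prod_map _ _ (measurable_comp_perm σ) measurable_id, h σ, Measure.map_id]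
  conv_rhs => rw [hprod, Measure.map_map (hu _) ((measurable_comp_perm σ).prodMap measurable_id)]
  congr 1
  funext z k
  simp only [Function.comp_apply, Prod.map_fst, Prod.map_snd, id, Function.update_apply,
    Equiv.eq_symm_apply]

end IsPermInvariant

/-! ### Product plans and the swapping construction -/

theorem lintegral_pairCost_pi_le (s : ℝ) (η : Measure (Rd d)) [IsProbabilityMeasure η] :
    ∫⁻ x, pairCost s x ∂(Measure.pi fun _ : Fin N => η) ≤
      N * (N * ∫⁻ x, ∫⁻ y, rieszCost s (x - y) ∂η ∂η) := by
  have hc := measurable_rieszCost (d := d) s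
  have hpair : ∀ i j : Fin N, j ≠ i →
      ∫⁻ x, rieszCost s (x i - x j) ∂(Measure.pi fun _ : Fin N => η) =
        ∫⁻ x, ∫⁻ y, rieszCost s (x - y) ∂η ∂η := by
    intro i j hji
    have hind := (ProbabilityTheory.iIndepFun_pi (μ := fun _ : Fin N => η)
      (X := fun _ x => x) fun _ => aemeasurable_id).indepFun hji.symm
    have hmap := (ProbabilityTheory.indepFun_iff_map_prod_eq_prod_map_map
      (measurable_pi_apply i).aemeasurable (measurable_pi_apply j).aemeasurable).1 hind
    rw [(measurePreserving_eval (fun _ : Fin N => η) i).map_eq,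
      (measurePreserving_eval (fun _ : Fin N => η) j).map_eq] at hmap
    rw [← lintegral_prod (fun z : Rd d × Rd d => rieszCost s (z.1 - z.2))
      (Measurable.aemeasurable (by fun_prop)), ← hmap, lintegral_map (by fun_prop) (by fun_prop)]
  unfold pairCost
  rw [lintegral_finsetSum _ fun i _ => Finset.measurable_sum _ fun j _ => by fun_prop]
  calc _ = ∑ i : Fin N, ∑ j ∈ Finset.univ.filter (fun j => j ≠ i),
        ∫⁻ x, ∫⁻ y, rieszCost s (x - y) ∂η ∂η := by
        refine Finset.sum_congr rfl fun i _ => ?_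
        rw [lintegral_finsetSum _ fun j _ => by fun_prop]
        exact Finset.sum_congr rfl fun j hj => hpair i j (by simpa using hj)
    _ ≤ ∑ i : Fin N, ∑ j : Fin N, ∫⁻ x, ∫⁻ y, rieszCost s (x - y) ∂η ∂η := by
        gcongr
        exact Finset.subset_univ _
    _ = _ := by simp

theorem otCost_le_meanFieldEnergy (s : ℝ) (μ : ProbabilityMeasure (Rd d)) :
    otCost N s μ ≤ N * (N * meanFieldEnergy s μ) := by
  let γ : ProbabilityMeasure (Fin N → Rd d) :=
    ⟨Measure.pi fun _ => (μ : Measure (Rd d)), inferInstance⟩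
  refine (iInf₂_le γ ⟨IsPermInvariant.pi _, fun i => ?_⟩).trans (lintegral_pairCost_pi_le s _)
  exact (measurePreserving_eval (fun _ : Fin N => (μ : Measure (Rd d))) i).map_eq

/-- The swapping construction: the part of a plan living outside of `B` is recombined with
independent copies of its part living in `A ⊆ B`. -/
theorem exists_swapped_plan {μ : ProbabilityMeasure (Rd d)}
    {γ : ProbabilityMeasure (Fin N → Rd d)} (hγ : γ ∈ symPlans N μ) (i₀ : Fin N)
    {A B : Set (Fin N → Rd d)} (hA : MeasurableSet A) (hB : MeasurableSet B) (hAB : A ⊆ B)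
    (hAσ : ∀ (σ : Equiv.Perm (Fin N)) (x : Fin N → Rd d), (fun i => x (σ i)) ∈ A ↔ x ∈ A)
    (hBσ : ∀ (σ : Equiv.Perm (Fin N)) (x : Fin N → Rd d), (fun i => x (σ i)) ∈ B ↔ x ∈ B)
    (hA0 : (γ : Measure (Fin N → Rd d)) A ≠ 0)
    (hm : N * (γ : Measure (Fin N → Rd d)) Bᶜ ≤ (γ : Measure (Fin N → Rd d)) A) :
    ∃ γ' ∈ symPlans N μ, ∀ s, planCost s γ' ≤
      ∫⁻ x in B, pairCost s x ∂(γ : Measure (Fin N → Rd d)) +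
      N * ((γ : Measure (Fin N → Rd d)) Bᶜ * (((γ : Measure (Fin N → Rd d)) A)⁻¹ *
          ∫⁻ x in A, pairCost s x ∂(γ : Measure (Fin N → Rd d))) +
        2 * (N * (((γ : Measure (Fin N → Rd d)) A)⁻¹ *
          ∫⁻ x in Bᶜ, (∫⁻ y, rieszCost s (x i₀ - y) ∂(μ : Measure (Rd d)))
            ∂(γ : Measure (Fin N → Rd d))))) +
      (γ : Measure (Fin N → Rd d)) Bᶜ * (N * (N * (((γ : Measure (Fin N → Rd d)) A)⁻¹ *
        (((γ : Measure (Fin N → Rd d)) A)⁻¹ * meanFieldEnergy s μ)))) := by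
  set g : Measure (Fin N → Rd d) := (γ : Measure (Fin N → Rd d)) with hg_def
  have hg : IsPermInvariant g := hγ.1
  set m : ℝ≥0∞ := g Bᶜ with hm_def
  set κ : ℝ≥0∞ := g A with hκ_def
  have hκ_top : κ ≠ ∞ := measure_ne_top _ _
  have heval : ∀ i : Fin N, Measurable fun x : Fin N → Rd d => x i := measurable_pi_apply
  let H : Measure (Fin N → Rd d) := κ⁻¹ • g.restrict A
  have hH : IsPermInvariant H := (hg.restrict hA hAσ).smul _
  have : IsProbabilityMeasure H := ⟨by
    simp only [H, Measure.smul_apply, Measure.restrict_apply_univ, smul_eq_mul]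
    exact ENNReal.inv_mul_cancel hA0 hκ_top⟩
  let ν : Measure (Rd d) := (g.restrict Bᶜ).map fun x => x i₀
  have hν_univ : ν Set.univ = m := by
    simp only [ν]
    rw [Measure.map_apply (heval i₀) MeasurableSet.univ, Set.preimage_univ,
      Measure.restrict_apply_univ]
  have : IsFiniteMeasure ν := ⟨by rw [hν_univ]; exact measure_lt_top _ _⟩
  let η : Measure (Rd d) := H.map fun x => x i₀
  have hη : ∀ i, H.map (fun x => x i) = η := fun i => hH.map_eval_eq i i₀
  have : IsProbabilityMeasure η := Measure.isProbabilityMeasure_map (heval i₀).aemeasurable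
  -- Domination by `μ` turns every interaction with an `η`-distributed point into one with `μ`,
  -- hence into mean-field quantities.
  have hη_le : η ≤ κ⁻¹ • (μ : Measure (Rd d)) := by
    simp only [η, H]
    rw [Measure.map_smul, ← hγ.2 i₀]
    gcongr
    · exact heval i₀
    · exact Measure.restrict_le_self
  let P : Fin N → Measure (Fin N → Rd d) := fun i =>
    (H.prod ν).map fun z => Function.update z.1 i z.2
  have hu : ∀ i : Fin N, Measurable fun z : (Fin N → Rd d) × Rd d => Function.update z.1 i z.2 :=
    fun i => measurable_update'
  -- Each of the `N` measures `P i` has mass `m`, and with the final product term they use up `N *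
  -- m` of `η` in every marginal. This is the fraction `θ` of the part in `A`, available since `θ ≤
  -- 1`.
  let θ : ℝ≥0∞ := N * m * κ⁻¹
  have hθ : θ ≤ 1 := by
    calc θ ≤ κ * κ⁻¹ := by simp only [θ]; gcongr
      _ = 1 := ENNReal.mul_inv_cancel hA0 hκ_top
  -- In each slot `∑ i, P i` contributes one copy of `ν` and `N - 1` copies of `m • η`; the product
  -- term supplies the missing copy.
  let G : Measure (Fin N → Rd d) := g.restrict (B \ A) + (1 - θ) • g.restrict A +
    (∑ i, P i) + m • Measure.pi fun _ => η
  have hG : IsPermInvariant G := by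
    refine (((hg.restrict (hB.diff hA) fun σ x => ?_).add ((hg.restrict hA hAσ).smul _)).add
      (hH.sum_map_update ν)).add ((IsPermInvariant.pi η).smul _)
    rw [Set.mem_sdiff, Set.mem_sdiff, hAσ, hBσ]
  have hsplit : g.restrict (B \ A) + g.restrict A = g.restrict B := by
    have := Measure.restrict_inter_add_sdiff (μ := g) B hA
    rwa [Set.inter_eq_self_of_subset_right hAB, add_comm] at this
  have hPk : ∀ k i, (P i).map (fun x => x k) = if k = i then ν else m • η := by
    intro k i
    simp only [P]
    rw [Measure.map_map (heval k) (hu i)]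
    split_ifs with hki
    · subst hki
      have : (fun x : Fin N → Rd d => x k) ∘
          (fun z : (Fin N → Rd d) × Rd d => Function.update z.1 k z.2) = Prod.snd := by
        funext z; simp
      rw [this, Measure.map_snd_prod, measure_univ, one_smul]
    · have : (fun x : Fin N → Rd d => x k) ∘
          (fun z : (Fin N → Rd d) × Rd d => Function.update z.1 i z.2) =
          (fun x : Fin N → Rd d => x k) ∘ Prod.fst := by
        funext z; simp [hki]
      rw [this, ← Measure.map_map (heval k) measurable_fst, Measure.map_fst_prod, hν_univ,
        Measure.map_smul, hη]
  have hGk : ∀ k, G.map (fun x => x k) = μ := by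
    intro k
    have hsum : (∑ i, P i).map (fun x => x k) + m • η = ν + θ • (g.restrict A).map fun x => x k := by
      rw [← Measure.mapₗ_apply_of_measurable (heval k), map_sum]
      simp only [Measure.mapₗ_apply_of_measurable (heval k), hPk]
      have h1 : θ • (g.restrict A).map (fun x => x k) = ∑ i : Fin N, m • η := by
        rw [← hη k]
        simp only [θ, H, Measure.map_smul, Finset.sum_const, Finset.card_univ, Fintype.card_fin,
          smul_smul, ← Nat.cast_smul_eq_nsmul ℝ≥0∞, mul_assoc]
      rw [h1, ← Finset.add_sum_erase _ _ (Finset.mem_univ k),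
        ← Finset.add_sum_erase _ (fun _ => m • η) (Finset.mem_univ k), if_pos rfl, add_assoc]
      congr 1
      rw [add_comm]
      congr 1
      refine Finset.sum_congr rfl fun i hi => ?_
      rw [if_neg (Finset.ne_of_mem_erase hi).symm]
    have hν : (g.restrict Bᶜ).map (fun x => x k) = ν :=
      (hg.restrict hB.compl fun σ x => not_congr (hBσ σ x)).map_eval_eq k i₀
    calc G.map (fun x => x k)
        = (g.restrict (B \ A)).map (fun x => x k) + (1 - θ) • (g.restrict A).map (fun x => x k) +
          ((∑ i, P i).map (fun x => x k) + m • η) := by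
          simp only [G]
          rw [Measure.map_add _ _ (heval k), Measure.map_add _ _ (heval k),
            Measure.map_add _ _ (heval k), Measure.map_smul, Measure.map_smul,
            (measurePreserving_eval (fun _ : Fin N => η) k).map_eq, add_assoc]
      _ = (g.restrict (B \ A)).map (fun x => x k) +
          ((1 - θ) + θ) • (g.restrict A).map (fun x => x k) + ν := by
          rw [hsum, add_smul]
          abel
      _ = μ := by
          rw [tsub_add_cancel_of_le hθ, one_smul, ← Measure.map_add _ _ (heval k), hsplit, ← hν,
            ← Measure.map_add _ _ (heval k), Measure.restrict_add_restrict_compl hB, hγ.2 k]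
  have hG_prob : IsProbabilityMeasure G := ⟨by
    have := congrArg (fun m : Measure (Rd d) => m Set.univ) (hGk i₀)
    simpa [Measure.map_apply (heval i₀)] using this⟩
  refine ⟨⟨G, hG_prob⟩, ⟨hG, hGk⟩, fun s => ?_⟩
  have hc := measurable_rieszCost (d := d) s
  have hC := measurable_pairCost (d := d) (N := N) s
  have hP : ∀ i, ∫⁻ x, pairCost s x ∂(P i) ≤ m * (κ⁻¹ * ∫⁻ x in A, pairCost s x ∂g) +
      2 * (N * (κ⁻¹ * ∫⁻ x in Bᶜ, (∫⁻ y, rieszCost s (x i₀ - y) ∂(μ : Measure (Rd d))) ∂g)) := by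
    intro i
    have hU : Measurable fun x => ∫⁻ y, rieszCost s (x - y) ∂(μ : Measure (Rd d)) :=
      Measurable.lintegral_prod_right' (f := fun z : Rd d × Rd d => rieszCost s (z.1 - z.2))
        (by fun_prop)
    have hj : ∀ j : Fin N, ∫⁻ z, rieszCost s (z.2 - z.1 j) ∂(H.prod ν) ≤
        κ⁻¹ * ∫⁻ x in Bᶜ, (∫⁻ y, rieszCost s (x i₀ - y) ∂(μ : Measure (Rd d))) ∂g := by
      intro j
      rw [lintegral_prod_symm' _ (by fun_prop)]
      calc _ ≤ ∫⁻ x, κ⁻¹ * ∫⁻ y, rieszCost s (x - y) ∂(μ : Measure (Rd d)) ∂ν := by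
            refine lintegral_mono fun x => ?_
            dsimp only
            rw [← lintegral_map (f := fun y => rieszCost s (x - y)) (by fun_prop) (heval j), hη,
              ← smul_eq_mul, ← lintegral_smul_measure]
            exact lintegral_mono' hη_le le_rfl
        _ = _ := by
            rw [lintegral_const_mul _ hU, lintegral_map hU (heval i₀)]
    calc _ ≤ ∫⁻ z, (pairCost s z.1 + 2 * ∑ j, rieszCost s (z.2 - z.1 j)) ∂(H.prod ν) := by
          simp only [P]
          rw [lintegral_map hC (hu i)]
          exact lintegral_mono fun z => pairCost_update_le s _ i _
      _ = m * (κ⁻¹ * ∫⁻ x in A, pairCost s x ∂g) +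
          2 * ∑ j, ∫⁻ z, rieszCost s (z.2 - z.1 j) ∂(H.prod ν) := by
          rw [lintegral_add_left (by fun_prop), lintegral_const_mul _ (by fun_prop),
            lintegral_finsetSum _ fun j _ => by fun_prop]
          congr 1
          rw [lintegral_prod _ (by fun_prop)]
          simp only [lintegral_const, hν_univ]
          rw [lintegral_mul_const _ hC, lintegral_smul_measure, smul_eq_mul, mul_comm]
      _ ≤ m * (κ⁻¹ * ∫⁻ x in A, pairCost s x ∂g) + 2 * ∑ j : Fin N,
          κ⁻¹ * ∫⁻ x in Bᶜ, (∫⁻ y, rieszCost s (x i₀ - y) ∂(μ : Measure (Rd d))) ∂g := by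
          gcongr with j
          exact hj j
      _ = _ := by simp
  have hηη : ∫⁻ x, ∫⁻ y, rieszCost s (x - y) ∂η ∂η ≤ κ⁻¹ * (κ⁻¹ * meanFieldEnergy s μ) := by
    calc _ ≤ ∫⁻ x, ∫⁻ y, rieszCost s (x - y) ∂(κ⁻¹ • (μ : Measure (Rd d)))
          ∂(κ⁻¹ • (μ : Measure (Rd d))) :=
          lintegral_mono' hη_le fun x => lintegral_mono' hη_le le_rfl
      _ = _ := by
          simp only [lintegral_smul_measure, smul_eq_mul, meanFieldEnergy]
          rw [lintegral_const_mul' _ _ (ENNReal.inv_ne_top.2 hA0)]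
  show ∫⁻ x, pairCost s x ∂G ≤ _
  simp only [G]
  rw [lintegral_add_measure, lintegral_add_measure, lintegral_add_measure,
    lintegral_smul_measure, lintegral_smul_measure, lintegral_finsetSum_measure]
  gcongr
  · rw [← hsplit, lintegral_add_measure]
    gcongr
    exact mul_le_of_le_one_left' tsub_le_self
  · exact (Finset.sum_le_sum fun i _ => hP i).trans (by simp [mul_add])
  · exact mul_le_mul_right ((lintegral_pairCost_pi_le s η).trans (by gcongr)) _

/-- A plan can be modified, at an arbitrarily small extra cost for the exponent `s`, so that its
cost for a larger exponent `b` becomes finite. -/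
theorem exists_plan_finite_cost {s b : ℝ} (hs : 0 < s) (hsb : s ≤ b) (i₀ : Fin N)
    {μ : ProbabilityMeasure (Rd d)} (hμ : meanFieldEnergy b μ < ∞)
    {γ : ProbabilityMeasure (Fin N → Rd d)} (hγ : γ ∈ symPlans N μ) {L : ℝ≥0∞}
    (hL : planCost s γ < L) :
    ∃ γ' ∈ symPlans N μ, planCost b γ' ≠ ∞ ∧ planCost s γ' < L := by
  set g : Measure (Fin N → Rd d) := (γ : Measure (Fin N → Rd d)) with hg_def
  have hb : 0 < b := hs.trans_le hsb
  have hμs : meanFieldEnergy s μ < ∞ :=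
    (meanFieldEnergy_le_one_add hs.le hsb μ).trans_lt (ENNReal.add_lt_top.2 ⟨by simp, hμ⟩)
  let A : ℕ → Set (Fin N → Rd d) := fun n => {x | pairCost b x ≤ n}
  have hA : ∀ n, MeasurableSet (A n) := fun n =>
    measurableSet_le (measurable_pairCost b) measurable_const
  have hAσ : ∀ (n : ℕ) (σ : Equiv.Perm (Fin N)) (x : Fin N → Rd d),
      (fun i => x (σ i)) ∈ A n ↔ x ∈ A n := fun n σ x => by
    simp only [A, Set.mem_ofPred_eq, pairCost_comp_perm]
  have hA_mono : Monotone A := fun n k hnk x (hx : pairCost b x ≤ n) =>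
    show pairCost b x ≤ k from hx.trans (by exact_mod_cast hnk)
  -- Finite `s`-cost excludes collisions almost everywhere, and without collisions the `b`-cost is
  -- finite too.
  have htail : Tendsto (fun n => g (A n)ᶜ) atTop (𝓝 0) := by
    have h := tendsto_measure_iInter_atTop (μ := g) (s := fun n => (A n)ᶜ)
      (fun n => (hA n).compl.nullMeasurableSet)
      (fun n k hnk => Set.compl_subset_compl.2 (hA_mono hnk)) ⟨0, measure_ne_top _ _⟩
    have hnull : g (⋂ n, (A n)ᶜ) = 0 := by
      refine measure_mono_null (fun x hx => ?_)
        (ae_iff.1 (ae_lt_top (measurable_pairCost s) hL.ne_top))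
      have htop : pairCost b x = ∞ := by
        refine ENNReal.eq_top_of_forall_nnreal_le fun r => ?_
        obtain ⟨n, hn⟩ := exists_nat_ge r
        have hxn : (n : ℝ≥0∞) < pairCost b x := by
          simpa [A] using Set.mem_iInter.1 hx n
        exact le_trans (by exact_mod_cast hn) hxn.le
      show ¬ pairCost s x < ∞
      rw [not_lt, top_le_iff, pairCost_eq_top_iff hs, ← pairCost_eq_top_iff hb]
      exact htop
    rwa [hnull] at h
  -- The reservoir `A n₀` stays fixed while `n → ∞`, so the factors `(g (A n₀))⁻¹` remain constant
  -- and every correction term tends to zero.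
  obtain ⟨n₀, hn₀⟩ := (htail.eventually (gt_mem_nhds zero_lt_one)).exists
  have hκ : g (A n₀) ≠ 0 := fun h0 => by
    rw [prob_compl_eq_one_sub (hA n₀), h0, tsub_zero] at hn₀
    exact hn₀.ne rfl
  have hκ_inv : (g (A n₀))⁻¹ ≠ ∞ := ENNReal.inv_ne_top.2 hκ
  have hU : ∀ t, Measurable fun x => ∫⁻ y, rieszCost t (x - y) ∂(μ : Measure (Rd d)) := fun t =>
    Measurable.lintegral_prod_right' (f := fun z : Rd d × Rd d => rieszCost t (z.1 - z.2))
      ((measurable_rieszCost t).comp (by fun_prop))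
  have hUint : ∀ t, ∫⁻ x, (∫⁻ y, rieszCost t (x i₀ - y) ∂(μ : Measure (Rd d))) ∂g =
      meanFieldEnergy t μ := fun t => by
    rw [meanFieldEnergy]
    conv_rhs => rw [← hγ.2 i₀, lintegral_map (by rw [hγ.2 i₀]; exact hU t)
      (measurable_pi_apply i₀), hγ.2 i₀]
  -- The potential of `μ` is integrable against the marginal `μ`, with integral the mean-field
  -- energy; absolute continuity of the integral gives the limit.
  have hUtail : Tendsto (fun n => ∫⁻ x in (A n)ᶜ,
      (∫⁻ y, rieszCost s (x i₀ - y) ∂(μ : Measure (Rd d))) ∂g) atTop (𝓝 0) :=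
    tendsto_setLIntegral_zero (by rw [hUint]; exact hμs.ne) htail
  have hX : (g (A n₀))⁻¹ * ∫⁻ x in A n₀, pairCost s x ∂g ≠ ∞ :=
    ENNReal.mul_ne_top hκ_inv (((setLIntegral_le_lintegral _ _).trans_lt hL).ne_top)
  have hZ : ∀ t, meanFieldEnergy t μ < ∞ → (N : ℝ≥0∞) * (N * ((g (A n₀))⁻¹ *
      ((g (A n₀))⁻¹ * meanFieldEnergy t μ))) ≠ ∞ := fun t ht => by
    refine ENNReal.mul_ne_top (by simp) (ENNReal.mul_ne_top (by simp) ?_)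
    exact ENNReal.mul_ne_top hκ_inv (ENNReal.mul_ne_top hκ_inv ht.ne)
  have hlim : Tendsto (fun n => planCost s γ + N * (g (A n)ᶜ * ((g (A n₀))⁻¹ *
        ∫⁻ x in A n₀, pairCost s x ∂g) + 2 * (N * ((g (A n₀))⁻¹ * ∫⁻ x in (A n)ᶜ,
        (∫⁻ y, rieszCost s (x i₀ - y) ∂(μ : Measure (Rd d))) ∂g))) +
      g (A n)ᶜ * (N * (N * ((g (A n₀))⁻¹ * ((g (A n₀))⁻¹ * meanFieldEnergy s μ))))) atTop
      (𝓝 (planCost s γ + N * (0 * ((g (A n₀))⁻¹ * ∫⁻ x in A n₀, pairCost s x ∂g) +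
        2 * (N * ((g (A n₀))⁻¹ * 0))) +
        0 * (N * (N * ((g (A n₀))⁻¹ * ((g (A n₀))⁻¹ * meanFieldEnergy s μ)))))) := by
    refine (tendsto_const_nhds.add (ENNReal.Tendsto.const_mul (Tendsto.add ?_ ?_)
      (Or.inr (by simp)))).add ?_
    · exact ENNReal.Tendsto.mul_const htail (Or.inr hX)
    · exact ENNReal.Tendsto.const_mul (ENNReal.Tendsto.const_mul (ENNReal.Tendsto.const_mul hUtail
        (Or.inr hκ_inv)) (Or.inr (by simp))) (Or.inr (by simp))
    · exact ENNReal.Tendsto.mul_const htail (Or.inr (hZ s hμs))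
  simp only [zero_mul, mul_zero, add_zero] at hlim
  have hNm : ∀ᶠ n in atTop, (N : ℝ≥0∞) * g (A n)ᶜ < g (A n₀) := by
    have h := ENNReal.Tendsto.const_mul htail (Or.inr (ENNReal.natCast_ne_top N))
    rw [mul_zero] at h
    exact h.eventually (gt_mem_nhds (pos_iff_ne_zero.2 hκ))
  obtain ⟨n, hn, hnL, hnm⟩ := ((eventually_ge_atTop n₀).and
    ((hlim.eventually (gt_mem_nhds hL)).and hNm)).exists
  obtain ⟨γ', hγ', hcost⟩ := exists_swapped_plan hγ i₀ (hA n₀) (hA n) (hA_mono hn) (hAσ n₀)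
    (hAσ n) hκ hnm.le
  refine ⟨γ', hγ', ne_top_of_le_ne_top ?_ (hcost b), lt_of_le_of_lt (hcost s) ?_⟩
  · have hAfin : ∀ k, ∫⁻ x in A k, pairCost b x ∂g ≠ ∞ := fun k => by
      refine ne_top_of_le_ne_top (b := (k : ℝ≥0∞) * g (A k))
        (ENNReal.mul_ne_top (by simp) (measure_ne_top _ _)) ?_
      rw [← setLIntegral_const]
      exact setLIntegral_mono measurable_const fun x hx => hx
    refine ENNReal.add_ne_top.2 ⟨ENNReal.add_ne_top.2 ⟨hAfin n, ENNReal.mul_ne_top (by simp)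
      (ENNReal.add_ne_top.2 ⟨ENNReal.mul_ne_top (measure_ne_top _ _)
        (ENNReal.mul_ne_top hκ_inv (hAfin n₀)), ENNReal.mul_ne_top (by simp)
        (ENNReal.mul_ne_top (by simp) (ENNReal.mul_ne_top hκ_inv ?_))⟩)⟩,
      ENNReal.mul_ne_top (measure_ne_top _ _) (hZ b hμ)⟩
    exact ((setLIntegral_le_lintegral _ _).trans_lt ((hUint b).trans_lt hμ)).ne
  · refine lt_of_le_of_lt ?_ hnL
    gcongr
    exact setLIntegral_le_lintegral _ _

/-! ### Continuity in the exponent and conclusion -/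

/-- Continuity of the optimal transport cost in the exponent. -/
theorem tendsto_otCost_exponent {s₀ b : ℝ} (hs₀ : 0 < s₀) (hsb : s₀ < b) (i₀ : Fin N)
    {μ : ProbabilityMeasure (Rd d)} (hμ : meanFieldEnergy b μ < ∞) :
    Tendsto (fun s => otCost N s μ) (𝓝 s₀) (𝓝 (otCost N s₀ μ)) := by
  refine tendsto_order.2 ⟨fun a ha => eventually_lt_otCost hs₀ ha, fun L hL => ?_⟩
  have hex : ∃ γ ∈ symPlans N μ, planCost s₀ γ < L := by
    rw [otCost] at hL
    simpa only [iInf_lt_iff, exists_prop] using hL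
  obtain ⟨γ, hγ, hγL⟩ := hex
  obtain ⟨γ', hγ', hfin, hlt⟩ := exists_plan_finite_cost hs₀ hsb.le i₀ hμ hγ hγL
  filter_upwards [(tendsto_planCost_exponent hs₀ hsb γ' hfin).eventually (gt_mem_nhds hlt)]
    with s hs
  exact (iInf₂_le γ' hγ').trans_lt hs

theorem meanFieldEnergy_lt_top_of_memLp {b : ℝ} (hb : 0 < b) (hbd : b < d)
    (μ : ProbabilityMeasure (Rd d)) (ρ : Rd d → ℝ)
    (hρ : (μ : Measure (Rd d)) =
      (volume : Measure (Rd d)).withDensity (fun x => ENNReal.ofReal (ρ x)))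
    (hρ_Lp : MemLp ρ (ENNReal.ofReal (1 + b / (d : ℝ))) (volume : Measure (Rd d))) :
    meanFieldEnergy b μ < ∞ := by
  have hd0 : (0 : ℝ) < d := hb.trans hbd
  have hp : 0 < 1 + b / (d : ℝ) := by positivity
  let ρ' : Rd d → ℝ := hρ_Lp.1.mk ρ
  have hae : ρ =ᵐ[volume] ρ' := hρ_Lp.1.ae_eq_mk
  have hρ'_meas : Measurable ρ' := hρ_Lp.1.stronglyMeasurable_mk.measurable
  refine meanFieldEnergy_lt_top (by exact_mod_cast hd0) hb hbd μ
    (f := fun x => ENNReal.ofReal (ρ' x)) (ENNReal.measurable_ofReal.comp hρ'_meas) ?_ ?_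
  · rw [hρ]
    refine withDensity_congr_ae ?_
    filter_upwards [hae] with x hx
    rw [hx]
  · have h := ((memLp_congr_ae hae).1 hρ_Lp).2
    rw [eLpNorm_lt_top_iff_lintegral_rpow_enorm_lt_top (by simpa using hp) ENNReal.ofReal_ne_top,
      ENNReal.toReal_ofReal hp.le] at h
    refine lt_of_le_of_lt (lintegral_mono fun x => ?_) h
    gcongr
    rw [← ofReal_norm]
    exact ENNReal.ofReal_le_ofReal (Real.le_norm_self _)

end RieszTransport

theorem mainTheorem8 (d N : ℕ) (hN : 2 ≤ N) (a b : ℝ)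
    (hI : Set.Icc a b ⊆ Set.Ioo (0 : ℝ) (d : ℝ))
    (μ : ProbabilityMeasure (Rd d)) (ρ : Rd d → ℝ)
    (hρ_nonneg : ∀ᵐ x ∂(volume : Measure (Rd d)), 0 ≤ ρ x)
    (hρ_density : (μ : Measure (Rd d)) =
      (volume : Measure (Rd d)).withDensity (fun x => ENNReal.ofReal (ρ x)))
    (hρ_Lp : ∀ s ∈ Set.Icc a b,
      MemLp ρ (ENNReal.ofReal (1 + s / (d : ℝ))) (volume : Measure (Rd d))) :
    -- the quantities are finite and the infimum is attained
    (∀ s ∈ interior (Set.Icc a b),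
      otCost N s μ < ∞ ∧ meanFieldEnergy s μ < ∞ ∧
        ∃ γ : ProbabilityMeasure (Fin N → Rd d), IsOptimalPlan s μ γ) ∧
    -- (a) continuity of the optimal transport cost
    (∀ s₀ ∈ interior (Set.Icc a b),
      Tendsto (fun s => otCost N s μ) (𝓝 s₀) (𝓝 (otCost N s₀ μ))) ∧
    -- (a) weak subsequential convergence of optimal plans to an optimal plan
    (∀ s₀ ∈ interior (Set.Icc a b), ∀ (s : ℕ → ℝ)
      (γ : ℕ → ProbabilityMeasure (Fin N → Rd d)),
      (∀ n, s n ∈ interior (Set.Icc a b)) → Tendsto s atTop (𝓝 s₀) →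
      (∀ n, IsOptimalPlan (s n) μ (γ n)) →
      ∃ (φ : ℕ → ℕ) (γ₀ : ProbabilityMeasure (Fin N → Rd d)), StrictMono φ ∧
        IsOptimalPlan s₀ μ γ₀ ∧ Tendsto (fun k => γ (φ k)) atTop (𝓝 γ₀)) ∧
    -- (b) continuity of the exchange-correlation energy
    (∀ s₀ ∈ interior (Set.Icc a b),
      Tendsto (fun s => exchangeCorrelation N s μ) (𝓝 s₀)
        (𝓝 (exchangeCorrelation N s₀ μ))) := by
  let i₀ : Fin N := ⟨0, by omega⟩
  -- The closed endpoint `b` serves as the larger exponent for every interior `s`, since the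
  -- integrability of `ρ` is assumed there as well.
  have hpos : ∀ s ∈ interior (Set.Icc a b), 0 < s ∧ s < b ∧ meanFieldEnergy b μ < ∞ := by
    intro s hs
    have h0 := (hI (interior_subset hs)).1
    rw [interior_Icc] at hs
    have hb : b ∈ Set.Icc a b := ⟨(hs.1.trans hs.2).le, le_rfl⟩
    exact ⟨h0, hs.2, meanFieldEnergy_lt_top_of_memLp (hI hb).1 (hI hb).2 μ ρ hρ_density
      (hρ_Lp b hb)⟩
  have hMF : ∀ s ∈ interior (Set.Icc a b), meanFieldEnergy s μ < ∞ := by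
    intro s hs
    obtain ⟨h0, hsb, hμ⟩ := hpos s hs
    exact (meanFieldEnergy_le_one_add h0.le hsb.le μ).trans_lt (ENNReal.add_lt_top.2 ⟨by simp, hμ⟩)
  have hOT : ∀ s ∈ interior (Set.Icc a b), otCost N s μ < ∞ := fun s hs =>
    (otCost_le_meanFieldEnergy s μ).trans_lt (ENNReal.mul_lt_top (by simp)
      (ENNReal.mul_lt_top (by simp) (hMF s hs)))
  have hcont : ∀ s₀ ∈ interior (Set.Icc a b),
      Tendsto (fun s => otCost N s μ) (𝓝 s₀) (𝓝 (otCost N s₀ μ)) := by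
    intro s₀ hs₀
    obtain ⟨h0, hsb, hμ⟩ := hpos s₀ hs₀
    exact tendsto_otCost_exponent h0 hsb i₀ hμ
  refine ⟨fun s hs => ⟨hOT s hs, hMF s hs, exists_isOptimalPlan (hpos s hs).1 (hOT s hs).ne⟩,
    hcont, ?_, ?_⟩
  · intro s₀ hs₀ s γ _ hlim hγ
    obtain ⟨γ₀, hγ₀, φ, hφ, hγlim⟩ := (isCompact_symPlans μ).tendsto_subseq fun n => (hγ n).1
    refine ⟨φ, γ₀, hφ, ⟨hγ₀, le_antisymm ?_ (iInf₂_le γ₀ hγ₀)⟩, hγlim⟩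
    have hsφ := hlim.comp hφ.tendsto_atTop
    -- The costs of the minimizers are the optimal values, which converge to the optimal value at
    -- `s₀`; semicontinuity then forces the weak limit to be optimal.
    refine (planCost_le_liminf (hpos s₀ hs₀).1 hsφ hγlim).trans ?_
    rw [← ((hcont s₀ hs₀).comp hsφ).liminf_eq]
    exact liminf_le_liminf (Eventually.of_forall fun k => (hγ (φ k)).2.le)
  · intro s₀ hs₀
    obtain ⟨h0, hsb, hμ⟩ := hpos s₀ hs₀
    unfold exchangeCorrelation
    exact ((ENNReal.tendsto_toReal (hOT s₀ hs₀).ne).comp (hcont s₀ hs₀)).sub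
      (((ENNReal.tendsto_toReal (hMF s₀ hs₀).ne).comp
        (tendsto_meanFieldEnergy_exponent h0 hsb μ hμ.ne)).const_mul _)
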